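/- Let $T:[0,1)\to[0,1)$ be the map $$T(x)=\frac{1}{2\left[\frac{1}{1-x}\right]+1-\frac{1}{1-x}},$$ where $[y]$ denotes the integer part of $y$. Then: 1. $T$ has zero topological entropy, in the sense of Bowen with respect to the usual distance on $[0,1)$: if $N(n,\varepsilon)$ is the smallest cardinality of a set $S\subset[0,1)$ such that for every $x\in[0,1)$ there is $s\in S$ with $|T^k(x)-T^k(s)|<\varepsilon$ for all $0\le k<n$, then $\lim_{\varepsilon\to0}\limsup_{n\to\infty}\frac1n\log N(n,\varepsilon)=0$. 2. $T$ is minimal: for every $x\in[0,1)$ the orbit $\{T^n(x):n\ge 0\}$ is dense in $[0,1)$. 3. $T$ is uniquely ergodic: there is exactly one Borel probability measure $\mu$ on $[0,1)$ that is invariant under $T$, that is, with $\mu(T^{-1}A)=\mu(A)$ for every Borel set $A\subset[0,1)$. 4. The unique $T$-invariant Borel probability measure is not absolutely continuous with respect to Lebesgue measure on $[0,1)$. -/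

import Mathlib

open MeasureTheory Set

/-- The formula `x ↦ 1 / (2 [1 / (1 - x)] + 1 - 1 / (1 - x))`, where `[·]` is the integer part. -/
noncomputable def returnFormula (x : ℝ) : ℝ :=
  1 / (2 * (⌊1 / (1 - x)⌋ : ℝ) + 1 - 1 / (1 - x))

/-- The formula defines a map from `[0, 1)` to itself. -/
theorem returnFormula_mem {x : ℝ} (hx : x ∈ Ico (0 : ℝ) 1) :
    returnFormula x ∈ Ico (0 : ℝ) 1 := by
  obtain ⟨h0, h1⟩ := hx
  have hy : (1 : ℝ) ≤ 1 / (1 - x) := by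
    rw [le_div_iff₀ (by linarith)]; linarith
  have hf : (1 : ℝ) ≤ (⌊1 / (1 - x)⌋ : ℝ) := by
    exact_mod_cast Int.le_floor.mpr (by exact_mod_cast hy)
  have hlt := Int.lt_floor_add_one (1 / (1 - x))
  have hden : 1 < 2 * (⌊1 / (1 - x)⌋ : ℝ) + 1 - 1 / (1 - x) := by linarith
  unfold returnFormula
  refine ⟨div_nonneg zero_le_one (by linarith), ?_⟩
  rw [div_lt_one (by linarith)]
  exact hden

/-- The map `T : [0, 1) → [0, 1)`. -/
noncomputable def returnMap (x : Ico (0 : ℝ) 1) : Ico (0 : ℝ) 1 :=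
  ⟨returnFormula x, returnFormula_mem x.2⟩

/-- A map is minimal if every forward orbit `{x, f x, f (f x), …}` is dense. -/
def IsMinimalMap {X : Type*} [TopologicalSpace X] (f : X → X) : Prop :=
  ∀ x : X, DenseRange fun n : ℕ => f^[n] x

/-- `μ` is a probability measure that is invariant under `f`. -/
def IsInvariantProbability {X : Type*} [MeasurableSpace X] (f : X → X) (μ : Measure X) : Prop :=
  IsProbabilityMeasure μ ∧ MeasurePreserving f μ μ

/-- A map is uniquely ergodic if it has exactly one invariant probability measure. -/
def IsUniquelyErgodic {X : Type*} [MeasurableSpace X] (f : X → X) : Prop :=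
  ∃! μ : Measure X, IsInvariantProbability f μ

/-- Lebesgue measure on `[0, 1)`, that is, `A ↦ volume A` for Borel sets `A ⊆ [0, 1)`. -/
noncomputable def lebesgueIco : Measure (Ico (0 : ℝ) 1) :=
  (volume : Measure ℝ).comap Subtype.val

/-!
The map `T` is an odometer in disguise. Let `expand` be the map of `[0, 1)` that is `x / (1 - x)` on
`[0, 1/2)` and `2 - 1 / x` on `[1/2, 1)`, and let `A x = x / (1 + x)` and `B x = 1 / (2 - x)` be its
inverse branches. A computation with the formula gives `T ∘ A = B` and `T ∘ B = A ∘ T`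
(`returnMap_of_lt`, `returnMap_of_le`). So if a point is coded by the digits of its itinerary under
`expand` (`0` for the half `[0, 1/2)` and `1` for `[1/2, 1)`), read as a 2-adic integer with the
least significant digit first, then `T` adds one to the code: `address_returnMap`.

The points with given first `n` digits form a cell `[p / q, p' / q')` with `p' q - p q' = 1`, of
length `1 / (q q') ≤ 1 / (n + 1)` (`address_eq_iff`, `FracInterval.IsFarey.length_le`), and `T`
permutes the `2 ^ n` cells of level `n` cyclically. Hence every orbit visits every cell, which is
minimality, and one point from each cell shadows all orbits for all times, which gives zero entropy.

An invariant probability measure charges all cells of level `n` equally, and the cells form a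
`π`-system that generates the Borel sets, so there is at most one such measure. Conversely a measure
that charges all cells of each level equally is invariant, by the same uniqueness. It is obtained as
the image of Lebesgue measure under the map `coding` (the inverse of the Minkowski question mark
function), which carries binary expansions to itineraries under `expand`.

If this measure were absolutely continuous, then by the Lebesgue differentiation theorem the ratio
`2⁻ⁿ / |Iₙ|`, where `Iₙ` are the cells around `x`, would have a finite positive limit for almost
every `x` with respect to the measure, so that `|Iₙ₊₁| / |Iₙ| → 1/2`. But the cells are cut at the
mediant, and this forces `q / q' → 1`, which is impossible since one denominator of the next cell is
`q + q'`: see `not_tendsto_cell`.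
-/

namespace FareyOdometer

/-! ### The digits of a point, and the odometer -/

/-- The expanding Farey-type map of `[0, 1)`: it maps `[0, 1/2)` onto `[0, 1)` by `x / (1 - x)` and
`[1/2, 1)` onto `[0, 1)` by `2 - 1 / x`, both increasingly. -/
noncomputable def expand (x : Ico (0 : ℝ) 1) : Ico (0 : ℝ) 1 :=
  ⟨if (x : ℝ) < 1 / 2 then x / (1 - x) else 2 - 1 / x, by
    obtain ⟨x, h0, h1⟩ := x
    dsimp only
    split_ifs with h
    · exact ⟨div_nonneg h0 (by linarith), by rw [div_lt_one] <;> linarith⟩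
    · have hx : 0 < x := by linarith
      have h2 : 1 / x ≤ 2 := by rw [div_le_iff₀ hx]; linarith
      have h3 : 1 < 1 / x := by rw [lt_div_iff₀ hx]; linarith
      exact ⟨by linarith, by linarith⟩⟩

/-- The doubling map of `[0, 1)`. -/
noncomputable def double (u : Ico (0 : ℝ) 1) : Ico (0 : ℝ) 1 :=
  ⟨if (u : ℝ) < 1 / 2 then 2 * u else 2 * u - 1, by
    obtain ⟨u, h0, h1⟩ := u
    dsimp only
    split_ifs with h
    · exact ⟨by linarith, by linarith⟩
    · exact ⟨by linarith, by linarith⟩⟩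

/-- The half of `[0, 1)` that contains `x`: `0` for `[0, 1/2)` and `1` for `[1/2, 1)`. -/
noncomputable def digit (x : Ico (0 : ℝ) 1) : ℕ := if (x : ℝ) < 1 / 2 then 0 else 1

/-- The number `∑ k < n, digit (E^[k] x) * 2 ^ k`, which encodes the first `n` digits of the
itinerary of `x` under `E`, least significant digit first. -/
noncomputable def address (E : Ico (0 : ℝ) 1 → Ico (0 : ℝ) 1) : ℕ → Ico (0 : ℝ) 1 → ℕ
  | 0, _ => 0
  | n + 1, x => digit x + 2 * address E n (E x)

theorem expand_of_lt {x : Ico (0 : ℝ) 1} (h : (x : ℝ) < 1 / 2) :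
    (expand x : ℝ) = x / (1 - x) := if_pos h

theorem expand_of_le {x : Ico (0 : ℝ) 1} (h : 1 / 2 ≤ (x : ℝ)) :
    (expand x : ℝ) = 2 - 1 / x := if_neg h.not_gt

theorem double_of_lt {x : Ico (0 : ℝ) 1} (h : (x : ℝ) < 1 / 2) :
    (double x : ℝ) = 2 * x := if_pos h

theorem double_of_le {x : Ico (0 : ℝ) 1} (h : 1 / 2 ≤ (x : ℝ)) :
    (double x : ℝ) = 2 * x - 1 := if_neg h.not_gt

theorem digit_of_lt {x : Ico (0 : ℝ) 1} (h : (x : ℝ) < 1 / 2) : digit x = 0 := if_pos h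

theorem digit_of_le {x : Ico (0 : ℝ) 1} (h : 1 / 2 ≤ (x : ℝ)) : digit x = 1 := if_neg h.not_gt

theorem digit_le_one (x : Ico (0 : ℝ) 1) : digit x ≤ 1 := by
  unfold digit; split_ifs <;> simp

theorem address_lt (E : Ico (0 : ℝ) 1 → Ico (0 : ℝ) 1) (n : ℕ) (x : Ico (0 : ℝ) 1) :
    address E n x < 2 ^ n := by
  induction n generalizing x with
  | zero => simp [address]
  | succ n ih =>
    have h1 := ih (E x)
    have h2 := digit_le_one x
    rw [address, pow_succ]
    omega

theorem address_succ_eq_iff (E : Ico (0 : ℝ) 1 → Ico (0 : ℝ) 1) (n : ℕ) (x y : Ico (0 : ℝ) 1) :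
    address E (n + 1) x = address E (n + 1) y ↔
      digit x = digit y ∧ address E n (E x) = address E n (E y) := by
  have h1 := digit_le_one x
  have h2 := digit_le_one y
  simp only [address]
  omega

/-- Addresses are truncations of one another: this is what makes cells nested or disjoint. -/
theorem address_mod (E : Ico (0 : ℝ) 1 → Ico (0 : ℝ) 1) {m n : ℕ} (h : m ≤ n)
    (x : Ico (0 : ℝ) 1) : address E n x % 2 ^ m = address E m x := by
  induction m generalizing n x with
  | zero => simp [address, Nat.mod_one]
  | succ m ih =>
    obtain ⟨n, rfl⟩ : ∃ k, n = k + 1 := ⟨n - 1, by omega⟩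
    have h1 := ih (n := n) (by omega) (E x)
    have h2 := digit_le_one x
    have h3 := Nat.div_add_mod (address E n (E x)) (2 ^ m)
    have h4 := address_lt E m (E x)
    simp only [address]
    rw [h1] at h3
    rw [← h3, pow_succ, show digit x + 2 * (2 ^ m * (address E n (E x) / 2 ^ m)
      + address E m (E x)) = digit x + 2 * address E m (E x)
        + 2 ^ m * 2 * (address E n (E x) / 2 ^ m) by ring, Nat.add_mul_mod_self_left,
      Nat.mod_eq_of_lt (by omega)]

theorem coe_returnMap_of_lt {x : Ico (0 : ℝ) 1} (h : (x : ℝ) < 1 / 2) :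
    (returnMap x : ℝ) = (1 - x) / (2 - 3 * x) := by
  obtain ⟨x, h0, h1⟩ := x
  dsimp only [returnMap, returnFormula] at h ⊢
  have hp : 0 < 1 - x := by linarith
  have hf : ⌊1 / (1 - x)⌋ = 1 := by
    rw [Int.floor_eq_iff]
    constructor
    · rw [le_div_iff₀ hp]; push_cast; linarith
    · rw [div_lt_iff₀ hp]; push_cast; linarith
  have h2 : 2 - 3 * x ≠ 0 := by linarith
  have h3 : (2 : ℝ) * 1 + 1 - 1 / (1 - x) = (2 - 3 * x) / (1 - x) := by
    field_simp; ring
  rw [hf, Int.cast_one, h3, one_div_div]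

/-- On `[0, 1/2)` the map `T` carries the left branch of `expand` to the right branch. -/
theorem returnMap_of_lt {x : Ico (0 : ℝ) 1} (h : (x : ℝ) < 1 / 2) :
    digit (returnMap x) = 1 ∧ expand (returnMap x) = expand x := by
  have hT := coe_returnMap_of_lt h
  have h0 := x.2.1
  have hp : 0 < 2 - 3 * (x : ℝ) := by linarith
  have hge : 1 / 2 ≤ (returnMap x : ℝ) := by
    rw [hT, div_le_div_iff₀ two_pos hp]; linarith
  refine ⟨digit_of_le hge, Subtype.ext ?_⟩
  have h1 : 1 - (x : ℝ) ≠ 0 := by linarith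
  rw [expand_of_le hge, expand_of_lt h, hT, one_div_div]
  field_simp
  ring

/-- On `[1/2, 1)` the map `T` goes to the left branch of `expand` and carries over. -/
theorem returnMap_of_le {x : Ico (0 : ℝ) 1} (h : 1 / 2 ≤ (x : ℝ)) :
    digit (returnMap x) = 0 ∧ expand (returnMap x) = returnMap (expand x) := by
  have hE := expand_of_le h
  have hx1 := x.2.2
  have hT : (returnMap x : ℝ) = 1 / (2 * (⌊1 / (1 - (x : ℝ))⌋ : ℝ) + 1 - 1 / (1 - x)) := rfl
  have hTE : (returnMap (expand x) : ℝ) = 1 / (2 * (⌊1 / (1 - (expand x : ℝ))⌋ : ℝ) + 1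
    - 1 / (1 - expand x)) := rfl
  have hp : 0 < 1 - (x : ℝ) := by linarith
  have hy : 1 / (1 - (expand x : ℝ)) = 1 / (1 - (x : ℝ)) - 1 := by
    have h2 : (x : ℝ) ≠ 0 := by linarith
    rw [hE, show 1 - (2 - 1 / (x : ℝ)) = (1 - x) / x by field_simp; ring]
    field_simp
    ring
  rw [hy, Int.floor_sub_one] at hTE
  have hf : (2 : ℤ) ≤ ⌊1 / (1 - (x : ℝ))⌋ := by
    rw [Int.le_floor, le_div_iff₀ hp]; push_cast; linarith
  have hf' : (2 : ℝ) ≤ (⌊1 / (1 - (x : ℝ))⌋ : ℝ) := by exact_mod_cast hf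
  have hlt := Int.lt_floor_add_one (1 / (1 - (x : ℝ)))
  push_cast at hTE
  generalize (⌊1 / (1 - (x : ℝ))⌋ : ℝ) = f at *
  generalize 1 / (1 - (x : ℝ)) = y at *
  have hd : 2 < 2 * f + 1 - y := by linarith
  have hlt : (returnMap x : ℝ) < 1 / 2 := by
    rw [hT]; exact one_div_lt_one_div_of_lt two_pos hd
  refine ⟨digit_of_lt hlt, Subtype.ext ?_⟩
  rw [expand_of_lt hlt, hTE, hT]
  have h3 : 2 * f + 1 - y ≠ 0 := by linarith
  have h4 : 2 * f - y ≠ 0 := by linarith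
  have h5 : 2 * f + 1 - y - 1 ≠ 0 := by linarith
  have h6 : 2 * (f - 1) + 1 - (y - 1) ≠ 0 := by linarith
  rw [one_sub_div h3, div_div_div_cancel_right₀ h3]
  congr 1
  ring

/-- `T` is an odometer: it adds one to every address. -/
theorem address_returnMap (n : ℕ) (x : Ico (0 : ℝ) 1) :
    address expand n (returnMap x) ≡ address expand n x + 1 [MOD 2 ^ n] := by
  induction n generalizing x with
  | zero => simp [Nat.modEq_one]
  | succ n ih =>
    simp only [address]
    rcases lt_or_ge (x : ℝ) (1 / 2) with h | h
    · obtain ⟨h1, h2⟩ := returnMap_of_lt h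
      rw [h1, h2, digit_of_lt h]
      rw [show 1 + 2 * address expand n (expand x)
        = 0 + 2 * address expand n (expand x) + 1 by ring]
    · obtain ⟨h1, h2⟩ := returnMap_of_le h
      rw [h1, h2, digit_of_le h, pow_succ']
      have := (ih (expand x)).mul_left' 2
      rw [zero_add, show 1 + 2 * address expand n (expand x) + 1
        = 2 * (address expand n (expand x) + 1) by ring]
      exact this

theorem address_iterate_returnMap (n k : ℕ) (x : Ico (0 : ℝ) 1) :
    address expand n (returnMap^[k] x) ≡ address expand n x + k [MOD 2 ^ n] := by
  induction k with
  | zero => exact Nat.ModEq.refl _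
  | succ k ih =>
    rw [Function.iterate_succ_apply']
    exact (address_returnMap n _).trans (ih.add_right 1)

theorem address_eq_of_modEq {E F : Ico (0 : ℝ) 1 → Ico (0 : ℝ) 1} {n : ℕ} {x y : Ico (0 : ℝ) 1}
    (h : address E n x ≡ address F n y [MOD 2 ^ n]) : address E n x = address F n y :=
  h.eq_of_lt_of_lt (address_lt E n x) (address_lt F n y)

/-! ### Cells are Farey intervals -/

/-- The quadruple `(p, q, p', q')` of an interval `[p / q, p' / q')`. For the cells below the entries
are integers; real numbers avoid casts. -/
structure FracInterval where
  /-- numerator of the left endpoint -/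
  p : ℝ
  /-- denominator of the left endpoint -/
  q : ℝ
  /-- numerator of the right endpoint -/
  p' : ℝ
  /-- denominator of the right endpoint -/
  q' : ℝ

/-- The image of an interval under an inverse branch of `expand`, which is `x / (1 + x)` for the
digit `0` and `1 / (2 - x)` for the digit `1`. -/
def FracInterval.pull (d : ℕ) (I : FracInterval) : FracInterval :=
  if d = 0 then ⟨I.p, I.p + I.q, I.p', I.p' + I.q'⟩
  else ⟨I.q, 2 * I.q - I.p, I.q', 2 * I.q' - I.p'⟩

/-- The left one of the two intervals into which the mediant `(p + p') / (q + q')` cuts `I`. -/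
def FracInterval.left (I : FracInterval) : FracInterval := ⟨I.p, I.q, I.p + I.p', I.q + I.q'⟩

/-- The right one of the two intervals into which the mediant `(p + p') / (q + q')` cuts `I`. -/
def FracInterval.right (I : FracInterval) : FracInterval := ⟨I.p + I.p', I.q + I.q', I.p', I.q'⟩

theorem FracInterval.pull_left (d : ℕ) (I : FracInterval) :
    I.left.pull d = (I.pull d).left := by
  unfold pull left
  split_ifs <;> simp only [mk.injEq, true_and] <;> ring

theorem FracInterval.pull_right (d : ℕ) (I : FracInterval) :
    I.right.pull d = (I.pull d).right := by
  unfold pull right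
  split_ifs <;> simp only [mk.injEq, true_and, and_true] <;> ring

/-- The interval of the points that share the first `n` digits of `x`. -/
noncomputable def cell : ℕ → Ico (0 : ℝ) 1 → FracInterval
  | 0, _ => ⟨0, 1, 1, 1⟩
  | n + 1, x => (cell n (expand x)).pull (digit x)

/-- The arithmetic of Farey intervals in `[0, 1]`, with a lower bound for `q + q'` that forces the
cells of level `n` to be short. -/
structure FracInterval.IsFarey (n : ℕ) (I : FracInterval) : Prop where
  p_nonneg : 0 ≤ I.p
  one_le_q : 1 ≤ I.q
  one_le_q' : 1 ≤ I.q'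
  one_le_p' : 1 ≤ I.p'
  p'_le : I.p' ≤ I.q'
  p_add_one_le : I.p + 1 ≤ I.q
  det : I.p' * I.q - I.p * I.q' = 1
  le_add : (n : ℝ) + 2 ≤ I.q + I.q'

theorem isFarey_cell (n : ℕ) (x : Ico (0 : ℝ) 1) : (cell n x).IsFarey n := by
  induction n generalizing x with
  | zero => constructor <;> norm_num [cell]
  | succ n ih =>
    obtain ⟨h1, h2, h3, h4, h5, h6, h7, h8⟩ := ih (expand x)
    simp only [cell, FracInterval.pull]
    split_ifs with h
    · constructor <;> push_cast <;> linarith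
    · constructor <;> push_cast <;> linarith

/-- Passing to the next digit cuts a cell at its mediant. -/
theorem cell_succ (n : ℕ) (x : Ico (0 : ℝ) 1) :
    cell (n + 1) x = (cell n x).left ∨ cell (n + 1) x = (cell n x).right := by
  induction n generalizing x with
  | zero =>
    simp only [cell, FracInterval.pull, FracInterval.left, FracInterval.right]
    split_ifs <;> norm_num
  | succ n ih =>
    have key : cell (n + 2) x = (cell (n + 1) (expand x)).pull (digit x) := rfl
    rw [key]
    refine (ih (expand x)).imp (fun h => ?_) (fun h => ?_)
    · rw [h, FracInterval.pull_left]; rfl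
    · rw [h, FracInterval.pull_right]; rfl

/-- The points with the same first `n` digits as `x` fill the half-open interval `cell n x`. -/
theorem address_eq_iff (n : ℕ) (x y : Ico (0 : ℝ) 1) :
    address expand n y = address expand n x ↔
      (y : ℝ) ∈ Ico ((cell n x).p / (cell n x).q) ((cell n x).p' / (cell n x).q') := by
  induction n generalizing x y with
  | zero => simp [address, cell]
  | succ n ih =>
    rw [address_succ_eq_iff, ih]
    obtain ⟨h1, h2, h3, h4, h5, h6, h7, h8⟩ := isFarey_cell n (expand x)
    have y0 := y.2.1
    have y1 := y.2.2
    simp only [cell]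
    generalize cell n (expand x) = I at *
    have hq : 0 < I.q := by linarith
    have hq' : 0 < I.q' := by linarith
    have ha : 0 < I.p + I.q := by linarith
    have hb : 0 < I.p' + I.q' := by linarith
    have hc : 0 < 2 * I.q - I.p := by linarith
    have hd : 0 < 2 * I.q' - I.p' := by linarith
    rcases lt_or_ge (x : ℝ) (1 / 2) with hx | hx
    · rw [digit_of_lt hx, FracInterval.pull, if_pos rfl]
      dsimp only
      rcases lt_or_ge (y : ℝ) (1 / 2) with hy | hy
      · have hy' : 0 < 1 - (y : ℝ) := by linarith
        rw [digit_of_lt hy, expand_of_lt hy, mem_Ico, mem_Ico, div_le_div_iff₀ hq hy',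
          div_lt_div_iff₀ hy' hq', div_le_iff₀ ha, lt_div_iff₀ hb]
        constructor
        · rintro ⟨-, h, h'⟩; constructor <;> linarith
        · rintro ⟨h, h'⟩; refine ⟨rfl, ?_, ?_⟩ <;> linarith
      · rw [digit_of_le hy]
        refine iff_of_false (by simp) fun h => ?_
        have := (lt_div_iff₀ hb).1 h.2
        nlinarith
    · rw [digit_of_le hx, FracInterval.pull, if_neg one_ne_zero]
      dsimp only
      rcases lt_or_ge (y : ℝ) (1 / 2) with hy | hy
      · rw [digit_of_lt hy]
        refine iff_of_false (by simp) fun h => ?_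
        have := (div_le_iff₀ hc).1 h.1
        nlinarith
      · have hy' : 0 < (y : ℝ) := by linarith
        have hE : 2 - 1 / (y : ℝ) = (2 * y - 1) / y := by field_simp
        rw [digit_of_le hy, expand_of_le hy, hE, mem_Ico, mem_Ico, div_le_div_iff₀ hq hy',
          div_lt_div_iff₀ hy' hq', div_le_iff₀ hc, lt_div_iff₀ hd]
        constructor
        · rintro ⟨-, h, h'⟩; constructor <;> linarith
        · rintro ⟨h, h'⟩; refine ⟨rfl, ?_, ?_⟩ <;> linarith

theorem FracInterval.IsFarey.length_eq {n : ℕ} {I : FracInterval} (h : I.IsFarey n) :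
    I.p' / I.q' - I.p / I.q = 1 / (I.q * I.q') := by
  have h1 : I.q ≠ 0 := by linarith [h.one_le_q]
  have h2 : I.q' ≠ 0 := by linarith [h.one_le_q']
  rw [div_sub_div _ _ h2 h1, mul_comm I.q I.q', mul_comm I.q' I.p, h.det]

theorem FracInterval.IsFarey.length_le {n : ℕ} {I : FracInterval} (h : I.IsFarey n) :
    I.p' / I.q' - I.p / I.q ≤ 1 / (n + 1) := by
  rw [h.length_eq]
  have : (n : ℝ) + 1 ≤ I.q * I.q' := by
    nlinarith [h.le_add, mul_nonneg (sub_nonneg.2 h.one_le_q) (sub_nonneg.2 h.one_le_q')]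
  exact one_div_le_one_div_of_le (by positivity) this

theorem dist_le_of_address_eq {n : ℕ} {x y : Ico (0 : ℝ) 1}
    (h : address expand n x = address expand n y) : dist x y ≤ 1 / (n + 1) := by
  have hx := (address_eq_iff n y x).1 h
  have hy := (address_eq_iff n y y).1 rfl
  refine le_trans ?_ (isFarey_cell n y).length_le
  rw [Subtype.dist_eq, Real.dist_eq, abs_le]
  constructor <;> linarith [hx.1, hx.2, hy.1, hy.2]

theorem exists_forall_dist_lt {ε : ℝ} (hε : 0 < ε) : ∃ n : ℕ, ∀ x y : Ico (0 : ℝ) 1,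
    address expand n x = address expand n y → dist x y < ε := by
  obtain ⟨n, hn⟩ := exists_nat_one_div_lt hε
  exact ⟨n, fun x y h => (dist_le_of_address_eq h).trans_lt hn⟩

/-! ### Minimality and entropy -/

theorem isMinimalMap_returnMap : IsMinimalMap returnMap := by
  intro x
  refine Metric.denseRange_iff.2 fun y ε hε => ?_
  obtain ⟨n, hn⟩ := exists_forall_dist_lt hε
  -- the number of steps from the address of `x` to that of `y`, modulo `2 ^ n`
  refine ⟨address expand n y + (2 ^ n - address expand n x), hn _ _ ?_⟩
  refine (address_eq_of_modEq ((address_iterate_returnMap n _ x).trans ?_)).symm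
  have h := address_lt expand n x
  rw [show address expand n x + (address expand n y + (2 ^ n - address expand n x))
    = address expand n y + 2 ^ n by omega]
  exact Nat.add_modEq_right

theorem coverEntropy_returnMap :
    Dynamics.coverEntropy returnMap (univ : Set (Ico (0 : ℝ) 1)) = 0 := by
  refine le_antisymm (iSup₂_le fun U hU => ?_)
    (Dynamics.coverEntropy_nonneg _ ⟨⟨0, by simp⟩, mem_univ _⟩)
  obtain ⟨ε, hε, hεU⟩ := Metric.mem_uniformity_dist.1 hU
  obtain ⟨m, hm⟩ := exists_forall_dist_lt hε
  -- one point from each cell of level `m` is a dynamical cover for all times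
  classical
  have : Nonempty (Ico (0 : ℝ) 1) := ⟨⟨0, by simp⟩⟩
  let s : Finset (Ico (0 : ℝ) 1) :=
    (Finset.range (2 ^ m)).image (Function.invFun (address expand m))
  have hcover : ∀ n, Dynamics.IsDynCoverOf returnMap univ U n (s : Set (Ico (0 : ℝ) 1)) := by
    intro n x _
    obtain ⟨y, hys, hy⟩ : ∃ y ∈ s, address expand m x = address expand m y :=
      ⟨_, Finset.mem_image_of_mem _ (Finset.mem_range.2 (address_lt expand m x)),
        (Function.invFun_eq (f := address expand m) ⟨x, rfl⟩).symm⟩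
    refine ⟨y, hys, Dynamics.mem_dynEntourage.2 fun k _ => hεU (hm _ _ ?_)⟩
    refine address_eq_of_modEq ((address_iterate_returnMap m k x).trans ?_)
    rw [hy]
    exact (address_iterate_returnMap m k y).symm
  have hs : (s.card : ENNReal) ≠ 0 := by
    have : s.Nonempty := (Finset.nonempty_range_iff.2 (by positivity)).image _
    exact_mod_cast this.card_ne_zero
  refine le_of_le_of_eq (ExpGrowth.expGrowthSup_monotone fun n => ?_)
    (ExpGrowth.expGrowthSup_const hs (ENNReal.natCast_ne_top _))
  have := (hcover n).coverMincard_le_card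
  simpa using ENat.toENNReal_mono this

/-! ### Measures that charge all cells of a level equally -/

theorem measurable_digit : Measurable digit :=
  Measurable.ite (measurableSet_lt measurable_subtype_coe measurable_const)
    measurable_const measurable_const

theorem measurable_expand : Measurable expand :=
  (Measurable.ite (measurableSet_lt measurable_subtype_coe measurable_const)
    (by fun_prop) (by fun_prop)).subtype_mk

theorem measurable_double : Measurable double :=
  (Measurable.ite (measurableSet_lt measurable_subtype_coe measurable_const)
    (by fun_prop) (by fun_prop)).subtype_mk

theorem measurable_address {E : Ico (0 : ℝ) 1 → Ico (0 : ℝ) 1} (hE : Measurable E) (n : ℕ) :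
    Measurable (address E n) := by
  induction n with
  | zero => exact measurable_const
  | succ n ih => exact measurable_digit.add ((ih.comp hE).const_mul 2)

theorem measurable_returnMap : Measurable returnMap := by
  refine Measurable.subtype_mk ?_
  unfold returnFormula
  have h : Measurable fun x : Ico (0 : ℝ) 1 => 1 / (1 - (x : ℝ)) := by fun_prop
  have h' : Measurable fun x : Ico (0 : ℝ) 1 => (⌊1 / (1 - (x : ℝ))⌋ : ℝ) :=
    (measurable_from_top (f := fun k : ℤ => (k : ℝ))).comp h.floor
  fun_prop

/-- The family of all cells of all levels. -/
def cells : Set (Set (Ico (0 : ℝ) 1)) :=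
  {s | ∃ n c, c < 2 ^ n ∧ s = address expand n ⁻¹' {c}}

theorem mem_cells_of_address (n : ℕ) (x : Ico (0 : ℝ) 1) :
    address expand n ⁻¹' {address expand n x} ∈ cells :=
  ⟨n, _, address_lt expand n x, rfl⟩

theorem isPiSystem_cells : IsPiSystem cells := by
  -- if two cells meet then the one of the higher level is contained in the other
  have key : ∀ m n : ℕ, m ≤ n → ∀ x : Ico (0 : ℝ) 1,
      address expand n ⁻¹' {address expand n x} ⊆ address expand m ⁻¹' {address expand m x} := by
    intro m n h x y hy
    simp only [mem_preimage, mem_singleton_iff] at hy ⊢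
    rw [← address_mod expand h y, hy, address_mod expand h x]
  rintro _ ⟨m, _, -, rfl⟩ _ ⟨n, _, -, rfl⟩ ⟨x, hx, hx'⟩
  rw [mem_preimage, mem_singleton_iff] at hx hx'
  subst hx hx'
  rcases le_total m n with h | h
  · rw [inter_eq_right.2 (key m n h x)]
    exact mem_cells_of_address n x
  · rw [inter_eq_left.2 (key n m h x)]
    exact mem_cells_of_address m x

theorem generateFrom_cells :
    (inferInstance : MeasurableSpace (Ico (0 : ℝ) 1)) = MeasurableSpace.generateFrom cells := by
  apply le_antisymm
  · rw [BorelSpace.measurable_eq (α := Ico (0 : ℝ) 1)]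
    refine MeasurableSpace.generateFrom_le fun U (hU : IsOpen U) => ?_
    -- an open set is the union of the countably many cells that it contains
    have hU' : U = ⋃ (p : ℕ × ℕ) (_ : p.2 < 2 ^ p.1 ∧ address expand p.1 ⁻¹' {p.2} ⊆ U),
        address expand p.1 ⁻¹' {p.2} := by
      refine Subset.antisymm (fun x hx => ?_) (iUnion₂_subset fun p hp => hp.2)
      obtain ⟨ε, hε, hεU⟩ := Metric.isOpen_iff.1 hU x hx
      obtain ⟨n, hn⟩ := exists_forall_dist_lt hε
      exact mem_iUnion₂.2 ⟨(n, address expand n x),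
        ⟨address_lt expand n x, fun y hy => hεU (hn y x hy)⟩, rfl⟩
    rw [hU']
    exact MeasurableSet.iUnion fun p => MeasurableSet.iUnion fun hp =>
      MeasurableSpace.measurableSet_generateFrom ⟨p.1, p.2, hp.1, rfl⟩
  · refine MeasurableSpace.generateFrom_le ?_
    rintro _ ⟨n, c, -, rfl⟩
    exact measurable_address measurable_expand n (measurableSet_singleton c)

/-- The measure `μ` gives the mass `2⁻ⁿ` to each of the `2 ^ n` cells of level `n`, where cells are
understood with respect to the itineraries of `E`. -/
def IsUniform (E : Ico (0 : ℝ) 1 → Ico (0 : ℝ) 1) (μ : Measure (Ico (0 : ℝ) 1)) : Prop :=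
  ∀ n c, c < 2 ^ n → μ (address E n ⁻¹' {c}) = (2 ^ n)⁻¹

theorem IsUniform.measure_univ {E : Ico (0 : ℝ) 1 → Ico (0 : ℝ) 1} {μ : Measure (Ico (0 : ℝ) 1)}
    (h : IsUniform E μ) : μ univ = 1 := by
  have := h 0 0 (by simp)
  rwa [show address E 0 ⁻¹' {0} = univ from eq_univ_of_forall fun x => rfl, pow_zero,
    inv_one] at this

theorem IsUniform.eq {μ ν : Measure (Ico (0 : ℝ) 1)} (hμ : IsUniform expand μ)
    (hν : IsUniform expand ν) : μ = ν := by
  have : IsProbabilityMeasure μ := ⟨hμ.measure_univ⟩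
  refine ext_of_generate_finite cells generateFrom_cells isPiSystem_cells ?_
    (hμ.measure_univ.trans hν.measure_univ.symm)
  rintro _ ⟨n, c, hc, rfl⟩
  rw [hμ n c hc, hν n c hc]

theorem preimage_returnMap_cell {n c d : ℕ} (hc : c < 2 ^ n) (hd : d < 2 ^ n)
    (h : c + 1 ≡ d [MOD 2 ^ n]) :
    returnMap ⁻¹' (address expand n ⁻¹' {d}) = address expand n ⁻¹' {c} := by
  ext x
  simp only [mem_preimage, mem_singleton_iff]
  have hx := address_returnMap n x
  constructor
  · intro hxd
    rw [hxd] at hx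
    exact Nat.ModEq.eq_of_lt_of_lt ((hx.symm.trans h.symm).add_right_cancel' 1)
      (address_lt expand n x) hc
  · rintro rfl
    exact (hx.trans h).eq_of_lt_of_lt (address_lt expand n _) hd

theorem isUniform_of_isInvariantProbability {μ : Measure (Ico (0 : ℝ) 1)}
    (h : IsInvariantProbability returnMap μ) : IsUniform expand μ := by
  obtain ⟨hp, hm⟩ := h
  intro n c hc
  have hmeas : ∀ d, MeasurableSet (address expand n ⁻¹' {d}) := fun d =>
    measurable_address measurable_expand n (measurableSet_singleton d)
  -- the cells of level `n` are permuted cyclically, so that they have the same mass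
  have hconst : ∀ d < 2 ^ n, μ (address expand n ⁻¹' {d}) = μ (address expand n ⁻¹' {0}) := by
    intro d hd
    induction d with
    | zero => rfl
    | succ d ih =>
      rw [← ih (by omega), ← preimage_returnMap_cell (by omega) hd rfl,
        hm.measure_preimage (hmeas _).nullMeasurableSet]
  have hsum : ∑ d ∈ Finset.range (2 ^ n), μ (address expand n ⁻¹' {d}) = 1 := by
    rw [sum_measure_preimage_singleton _ fun d _ => hmeas d, ← hp.measure_univ]
    congr 1
    exact eq_univ_of_forall fun x => by simpa using address_lt expand n x
  rw [Finset.sum_congr rfl fun d hd => hconst d (Finset.mem_range.1 hd), ← hconst c hc,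
    Finset.sum_const, Finset.card_range, nsmul_eq_mul] at hsum
  rw [mul_comm] at hsum
  simpa using ENNReal.eq_inv_of_mul_eq_one_left hsum

theorem IsUniform.isInvariantProbability {μ : Measure (Ico (0 : ℝ) 1)} (h : IsUniform expand μ) :
    IsInvariantProbability returnMap μ := by
  refine ⟨⟨h.measure_univ⟩, measurable_returnMap, IsUniform.eq (fun n d hd => ?_) h⟩
  rw [Measure.map_apply measurable_returnMap
    (measurable_address measurable_expand n (measurableSet_singleton d))]
  have hpos : 0 < 2 ^ n := by positivity
  have hc : (d + (2 ^ n - 1)) % 2 ^ n < 2 ^ n := Nat.mod_lt _ hpos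
  rw [preimage_returnMap_cell hc hd, h n _ hc]
  refine ((Nat.mod_modEq _ _).add_right 1).trans ?_
  rw [show d + (2 ^ n - 1) + 1 = d + 2 ^ n by omega]
  exact Nat.add_modEq_right

/-! ### Existence: the image of Lebesgue measure under the coding -/

theorem isUniform_double_lebesgueIco : IsUniform double lebesgueIco := by
  -- the cells of the doubling map are the dyadic intervals
  have key : ∀ n c : ℕ, c < 2 ^ n → ∃ a : ℝ, 0 ≤ a ∧ a + (2 ^ n)⁻¹ ≤ 1 ∧
      ∀ u : Ico (0 : ℝ) 1, address double n u = c ↔ (u : ℝ) ∈ Ico a (a + (2 ^ n)⁻¹) := by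
    intro n
    induction n with
    | zero =>
      intro c hc
      exact ⟨0, le_rfl, by simp, fun u => by simp [address]; omega⟩
    | succ n ih =>
      intro c hc
      rw [pow_succ] at hc
      obtain ⟨a, ha0, ha1, ha⟩ := ih (c / 2) (by omega)
      have hn : ((2 : ℝ) ^ (n + 1))⁻¹ = (2 ^ n)⁻¹ / 2 := by rw [pow_succ, mul_inv]; rfl
      have hpos : 0 < ((2 : ℝ) ^ n)⁻¹ := by positivity
      rw [hn]
      generalize ((2 : ℝ) ^ n)⁻¹ = l at *
      rcases Nat.even_or_odd' c with ⟨e, rfl | rfl⟩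
      · refine ⟨a / 2, by linarith, by linarith, fun u => ?_⟩
        rw [show 2 * e / 2 = e by omega] at ha
        simp only [address]
        rcases lt_or_ge (u : ℝ) (1 / 2) with hu | hu
        · rw [digit_of_lt hu, show 0 + 2 * address double n (double u) = 2 * e ↔
            address double n (double u) = e by omega, ha, double_of_lt hu]
          constructor <;> rintro ⟨h, h'⟩ <;> constructor <;> linarith
        · rw [digit_of_le hu]
          refine iff_of_false (by omega) fun h => ?_
          linarith [h.2]
      · refine ⟨a / 2 + 1 / 2, by linarith, by linarith, fun u => ?_⟩
        rw [show (2 * e + 1) / 2 = e by omega] at ha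
        simp only [address]
        rcases lt_or_ge (u : ℝ) (1 / 2) with hu | hu
        · rw [digit_of_lt hu]
          refine iff_of_false (by omega) fun h => ?_
          linarith [h.1]
        · rw [digit_of_le hu, show 1 + 2 * address double n (double u) = 2 * e + 1 ↔
            address double n (double u) = e by omega, ha, double_of_le hu]
          constructor <;> rintro ⟨h, h'⟩ <;> constructor <;> linarith
  intro n c hc
  obtain ⟨a, ha0, ha1, ha⟩ := key n c hc
  have himage : ((↑) '' (address double n ⁻¹' {c}) : Set ℝ) = Ico a (a + (2 ^ n)⁻¹) := by
    ext u
    constructor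
    · rintro ⟨v, hv, rfl⟩
      exact (ha v).1 hv
    · intro hu
      have hu' : u ∈ Ico (0 : ℝ) 1 := ⟨ha0.trans hu.1, hu.2.trans_le ha1⟩
      exact ⟨⟨u, hu'⟩, (ha ⟨u, hu'⟩).2 hu, rfl⟩
  rw [lebesgueIco, comap_subtype_coe_apply measurableSet_Ico, himage, Real.volume_Ico,
    add_sub_cancel_left, ENNReal.ofReal_inv_of_pos (by positivity), ENNReal.ofReal_pow two_pos.le]
  norm_num

/-- The inverse branch of `expand` on `[0, 1]` for the digit of `u`. -/
noncomputable def branch (u : Ico (0 : ℝ) 1) (t : ℝ) : ℝ :=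
  if (u : ℝ) < 1 / 2 then t / (1 + t) else 1 / (2 - t)

theorem branch_mono (u : Ico (0 : ℝ) 1) {s t : ℝ} (hs : 0 ≤ s) (hst : s ≤ t) (ht : t ≤ 1) :
    branch u s ≤ branch u t := by
  unfold branch
  split_ifs
  · rw [div_le_div_iff₀ (by linarith) (by linarith)]; linarith
  · exact one_div_le_one_div_of_le (by linarith) (by linarith)

theorem branch_nonneg (u : Ico (0 : ℝ) 1) {t : ℝ} (hs : 0 ≤ t) (ht : t ≤ 1) :
    0 ≤ branch u t := by
  unfold branch
  split_ifs
  · positivity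
  · exact one_div_nonneg.2 (by linarith)

theorem branch_le_one (u : Ico (0 : ℝ) 1) {t : ℝ} (hs : 0 ≤ t) (ht : t ≤ 1) :
    branch u t ≤ 1 := by
  unfold branch
  split_ifs
  · rw [div_le_one (by linarith)]; linarith
  · rw [div_le_one (by linarith)]; linarith

theorem continuousAt_branch (u : Ico (0 : ℝ) 1) {t : ℝ} (hs : 0 ≤ t) (ht : t ≤ 1) :
    ContinuousAt (branch u) t := by
  unfold branch
  split_ifs
  · exact continuousAt_id.div (by fun_prop) (by dsimp; linarith)
  · exact continuousAt_const.div (by fun_prop) (by linarith)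

/-- The left endpoint of the interval whose first `n` digits are those of `u` under doubling. -/
noncomputable def codingApprox : ℕ → Ico (0 : ℝ) 1 → ℝ
  | 0, _ => 0
  | n + 1, u => branch u (codingApprox n (double u))

theorem codingApprox_mem (n : ℕ) (u : Ico (0 : ℝ) 1) : codingApprox n u ∈ Icc (0 : ℝ) 1 := by
  induction n generalizing u with
  | zero => simp [codingApprox]
  | succ n ih =>
    exact ⟨branch_nonneg u (ih _).1 (ih _).2, branch_le_one u (ih _).1 (ih _).2⟩

theorem codingApprox_monotone (u : Ico (0 : ℝ) 1) : Monotone fun n => codingApprox n u := by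
  refine monotone_nat_of_le_succ fun n => ?_
  induction n generalizing u with
  | zero => exact (codingApprox_mem 1 u).1
  | succ n ih => exact branch_mono u (codingApprox_mem n _).1 (ih _) (codingApprox_mem (n + 1) _).2

/-- The point of `[0, 1]` whose `expand`-itinerary is the binary expansion of `u`: the inverse of
the Minkowski question mark function. -/
noncomputable def codingLimit (u : Ico (0 : ℝ) 1) : ℝ := ⨆ n, codingApprox n u

theorem tendsto_codingApprox (u : Ico (0 : ℝ) 1) :
    Filter.Tendsto (fun n => codingApprox n u) Filter.atTop (nhds (codingLimit u)) :=
  tendsto_atTop_ciSup (codingApprox_monotone u) ⟨1, by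
    rintro _ ⟨n, rfl⟩; exact (codingApprox_mem n u).2⟩

theorem codingLimit_mem (u : Ico (0 : ℝ) 1) : codingLimit u ∈ Icc (0 : ℝ) 1 :=
  isClosed_Icc.mem_of_tendsto (tendsto_codingApprox u)
    (Filter.Eventually.of_forall fun n => codingApprox_mem n u)

theorem codingLimit_eq (u : Ico (0 : ℝ) 1) : codingLimit u = branch u (codingLimit (double u)) :=
  tendsto_nhds_unique ((tendsto_codingApprox u).comp (Filter.tendsto_add_atTop_nat 1))
    ((continuousAt_branch u (codingLimit_mem _).1 (codingLimit_mem _).2).tendsto.comp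
      (tendsto_codingApprox (double u)))

/-- The limit does not reach `1` because the binary digits of `u < 1` produced by `double` are not
all equal to `1`. -/
theorem codingLimit_lt_one (u : Ico (0 : ℝ) 1) : codingLimit u < 1 := by
  obtain ⟨k, hk⟩ : ∃ k : ℕ, 1 < 2 ^ k * (1 - (u : ℝ)) := by
    obtain ⟨k, hk⟩ := pow_unbounded_of_one_lt (1 / (1 - (u : ℝ))) one_lt_two
    exact ⟨k, (div_lt_iff₀ (by linarith [u.2.2])).1 hk⟩
  induction k generalizing u with
  | zero => linarith [u.2.1, pow_zero (2 : ℝ)]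
  | succ k ih =>
    rw [codingLimit_eq]
    obtain ⟨h0, h1⟩ := codingLimit_mem (double u)
    rcases lt_or_ge (u : ℝ) (1 / 2) with hu | hu
    · rw [branch, if_pos hu, div_lt_one (by linarith)]; linarith
    · have := ih (double u) (by rw [double_of_le hu]; rw [pow_succ] at hk; linarith)
      rw [branch, if_neg hu.not_gt, div_lt_one (by linarith)]; linarith

/-- The map `codingLimit`, with values in `[0, 1)`. -/
noncomputable def coding (u : Ico (0 : ℝ) 1) : Ico (0 : ℝ) 1 :=
  ⟨codingLimit u, (codingLimit_mem u).1, codingLimit_lt_one u⟩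

/-- The map `coding` intertwines `double` with `expand` and preserves digits. -/
theorem digit_coding (u : Ico (0 : ℝ) 1) :
    digit (coding u) = digit u ∧ expand (coding u) = coding (double u) := by
  have hc : (coding u : ℝ) = branch u (coding (double u)) := codingLimit_eq u
  obtain ⟨h0, h1⟩ := (coding (double u)).2
  rcases lt_or_ge (u : ℝ) (1 / 2) with hu | hu
  · rw [branch, if_pos hu] at hc
    have hlt : (coding u : ℝ) < 1 / 2 := by
      rw [hc, div_lt_div_iff₀ (by linarith) two_pos]; linarith
    refine ⟨(digit_of_lt hlt).trans (digit_of_lt hu).symm, Subtype.ext ?_⟩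
    have h2 : 1 + (coding (double u) : ℝ) ≠ 0 := by linarith
    rw [expand_of_lt hlt, hc, one_sub_div h2, div_div_div_cancel_right₀ h2]
    simp
  · rw [branch, if_neg hu.not_gt] at hc
    have hle : 1 / 2 ≤ (coding u : ℝ) := by
      rw [hc]; exact one_div_le_one_div_of_le (by linarith) (by linarith)
    refine ⟨(digit_of_le hle).trans (digit_of_le hu).symm, Subtype.ext ?_⟩
    rw [expand_of_le hle, hc, one_div_one_div]
    ring

theorem address_coding (n : ℕ) (u : Ico (0 : ℝ) 1) :
    address expand n (coding u) = address double n u := by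
  induction n generalizing u with
  | zero => rfl
  | succ n ih => simp only [address, digit_coding, ih]

theorem preimage_coding_cell (n c : ℕ) :
    coding ⁻¹' (address expand n ⁻¹' {c}) = address double n ⁻¹' {c} := by
  ext u
  simp [address_coding]

theorem measurable_coding : Measurable coding := by
  have h : @Measurable _ _ _ (MeasurableSpace.generateFrom cells) coding := by
    refine measurable_generateFrom ?_
    rintro _ ⟨n, c, -, rfl⟩
    rw [preimage_coding_cell]
    exact measurable_address measurable_double n (measurableSet_singleton c)
  rwa [← generateFrom_cells] at h

theorem isUniform_map_coding : IsUniform expand (Measure.map coding lebesgueIco) := by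
  intro n c hc
  rw [Measure.map_apply measurable_coding
    (measurable_address measurable_expand n (measurableSet_singleton c)), preimage_coding_cell,
    isUniform_double_lebesgueIco n c hc]

theorem isUniquelyErgodic_returnMap : IsUniquelyErgodic returnMap :=
  ⟨_, isUniform_map_coding.isInvariantProbability, fun _ hν =>
    (isUniform_of_isInvariantProbability hν).eq isUniform_map_coding⟩

/-! ### Singularity -/

open Filter Topology

/-- If one of the two parts into which the mediant cuts a Farey interval has nearly half of its
length, then the denominators of the endpoints are nearly equal. -/
theorem FracInterval.denominators_close {I J : FracInterval} (hq : 0 < I.q) (hq' : 0 < I.q')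
    (hJ : J = I.left ∨ J = I.right) (h1 : 1.8 * (I.q * I.q') < J.q * J.q')
    (h2 : J.q * J.q' < 2.2 * (I.q * I.q')) : 0.8 * I.q' < I.q ∧ 0.8 * I.q < I.q' := by
  rcases hJ with rfl | rfl
  · have h3 : 1.8 * I.q' < I.q + I.q' := by
      refine lt_of_mul_lt_mul_left ?_ hq.le
      calc I.q * (1.8 * I.q') = 1.8 * (I.q * I.q') := by ring
        _ < _ := h1
    have h4 : I.q + I.q' < 2.2 * I.q' := by
      refine lt_of_mul_lt_mul_left ?_ hq.le
      calc I.q * (I.q + I.q') < _ := h2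
        _ = _ := by ring
    constructor <;> linarith
  · have h3 : 1.8 * I.q < I.q + I.q' := by
      refine lt_of_mul_lt_mul_right ?_ hq'.le
      calc 1.8 * I.q * I.q' = 1.8 * (I.q * I.q') := by ring
        _ < _ := h1
    have h4 : I.q + I.q' < 2.2 * I.q := by
      refine lt_of_mul_lt_mul_right ?_ hq'.le
      calc (I.q + I.q') * I.q' < _ := h2
        _ = _ := by ring
    constructor <;> linarith

/-- The ratio `2⁻ⁿ / |Iₙ|` of the mass and the length of the cells `Iₙ` around a point has no
positive limit. Otherwise the cells would be nearly bisected at all large levels. But an interval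
is nearly bisected only if its denominators `q`, `q'` are nearly equal, and one of the denominators
of the next interval is `q + q'`. -/
theorem not_tendsto_cell (x : Ico (0 : ℝ) 1) {L : ℝ} (hL : 0 < L) :
    ¬ Tendsto (fun n => (cell n x).q * (cell n x).q' / 2 ^ n) atTop (𝓝 L) := by
  intro h
  have hratio := (h.comp (tendsto_add_atTop_nat 1)).div h hL.ne'
  rw [div_self hL.ne'] at hratio
  obtain ⟨N, hN⟩ := eventually_atTop.1
    (hratio.eventually (Ioo_mem_nhds (show (0.9 : ℝ) < 1 by norm_num)
      (show (1 : ℝ) < 1.1 by norm_num)))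
  have key : ∀ n ≥ N, 0.8 * (cell n x).q' < (cell n x).q ∧
      0.8 * (cell n x).q < (cell n x).q' := by
    intro n hn
    have hq : 0 < (cell n x).q := by linarith [(isFarey_cell n x).one_le_q]
    have hq' : 0 < (cell n x).q' := by linarith [(isFarey_cell n x).one_le_q']
    obtain ⟨h1, h2⟩ := hN n hn
    have h3 : (cell (n + 1) x).q * (cell (n + 1) x).q' / 2 ^ (n + 1) /
        ((cell n x).q * (cell n x).q' / 2 ^ n) =
        (cell (n + 1) x).q * (cell (n + 1) x).q' / (2 * ((cell n x).q * (cell n x).q')) := by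
      rw [pow_succ]
      field_simp
    simp only [Function.comp_apply, Pi.div_apply] at h1 h2
    rw [h3, lt_div_iff₀ (by positivity)] at h1
    rw [h3, div_lt_iff₀ (by positivity)] at h2
    exact FracInterval.denominators_close hq hq' (cell_succ n x) (by linarith) (by linarith)
  have hq := (isFarey_cell N x).one_le_q
  have hq' := (isFarey_cell N x).one_le_q'
  obtain ⟨h1, h2⟩ := key N le_rfl
  obtain ⟨h3, h4⟩ := key (N + 1) (by omega)
  rcases cell_succ N x with h | h <;> rw [h] at h3 h4 <;>
    dsimp only [FracInterval.left, FracInterval.right] at h3 h4 <;> linarith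

theorem IsUniform.not_absolutelyContinuous {μ : Measure (Ico (0 : ℝ) 1)}
    (hμ : IsUniform expand μ) : ¬ μ ≪ lebesgueIco := by
  intro hac
  have : IsProbabilityMeasure μ := ⟨hμ.measure_univ⟩
  set ρ : Measure ℝ := μ.map Subtype.val with hρ_def
  have : IsProbabilityMeasure ρ :=
    Measure.isProbabilityMeasure_map measurable_subtype_coe.aemeasurable
  have hρ : ρ ≪ volume := by
    refine Measure.AbsolutelyContinuous.mk fun s hs h0 => ?_
    rw [hρ_def, Measure.map_apply measurable_subtype_coe hs]
    refine hac ?_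
    rw [lebesgueIco, comap_subtype_coe_apply measurableSet_Ico]
    exact measure_mono_null (image_preimage_subset _ _) h0
  -- at some point `x` the density of `μ` exists as a limit along intervals, and is positive
  let v := IsUnifLocDoublingMeasure.vitaliFamily (volume : Measure ℝ) 1
  have hae : ∀ᵐ x ∂ρ, Tendsto (fun a => ρ a / volume a) (v.filterAt x)
      (𝓝 (ρ.rnDeriv volume x)) ∧ ρ.rnDeriv volume x < ⊤ ∧ 0 < ρ.rnDeriv volume x := by
    filter_upwards [hρ.ae_le (v.ae_tendsto_rnDeriv ρ), hρ.ae_le (ρ.rnDeriv_lt_top volume),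
      Measure.rnDeriv_pos hρ] with x h1 h2 h3 using ⟨h1, h2, h3⟩
  obtain ⟨x, hx, htop, hpos⟩ := (ae_of_ae_map measurable_subtype_coe.aemeasurable hae).exists
  refine not_tendsto_cell x (ENNReal.toReal_pos hpos.ne' htop.ne) ?_
  -- the closures of the cells around `x`, as closed balls
  let a : ℕ → ℝ := fun n => (cell n x).p / (cell n x).q
  let b : ℕ → ℝ := fun n => (cell n x).p' / (cell n x).q'
  have hxab : ∀ n, (x : ℝ) ∈ Ico (a n) (b n) := fun n => (address_eq_iff n x x).1 rfl
  have hab : ∀ n, 0 < b n - a n := fun n => sub_pos.2 ((hxab n).1.trans_lt (hxab n).2)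
  have hball : ∀ n, Metric.closedBall ((a n + b n) / 2) ((b n - a n) / 2) = Icc (a n) (b n) :=
    fun n => (Real.Icc_eq_closedBall _ _).symm
  have hlim : Tendsto (fun n => (b n - a n) / 2) atTop (𝓝[>] 0) := by
    refine tendsto_nhdsWithin_iff.2 ⟨?_, Eventually.of_forall fun n => ?_⟩
    · refine squeeze_zero (fun n => ?_) (fun n => ?_) tendsto_one_div_add_atTop_nhds_zero_nat
      · exact (half_pos (hab n)).le
      · have : b n - a n ≤ 1 / (n + 1) := (isFarey_cell n x).length_le
        linarith [hab n]
    · exact half_pos (hab n)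
  have hfilter := IsUnifLocDoublingMeasure.tendsto_closedBall_filterAt (volume : Measure ℝ)
    (K := 1) (x := (x : ℝ)) (fun n => (a n + b n) / 2) _ hlim (Eventually.of_forall fun n => by
      rw [one_mul, hball n]; exact Ico_subset_Icc_self (hxab n))
  refine ((ENNReal.tendsto_toReal htop.ne).comp (hx.comp hfilter)).congr fun n => ?_
  have hmass : ρ (Icc (a n) (b n)) = (2 ^ n)⁻¹ := by
    rw [← measure_congr (hρ.ae_eq (Ico_ae_eq_Icc (μ := volume))), hρ_def,
      Measure.map_apply measurable_subtype_coe measurableSet_Ico,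
      ← hμ n _ (address_lt expand n x)]
    congr 1
    ext y
    exact (address_eq_iff n x y).symm
  have hlen : b n - a n = 1 / ((cell n x).q * (cell n x).q') := (isFarey_cell n x).length_eq
  simp only [Function.comp_apply]
  rw [hball, hmass, Real.volume_Icc, ENNReal.toReal_div,
    ENNReal.toReal_ofReal (hab n).le, hlen]
  simp [div_eq_mul_inv, mul_comm]

end FareyOdometer


theorem mainTheorem4 :
    -- the topological entropy (Bowen's definition, for the usual distance of `[0, 1)`) vanishes
    Dynamics.coverEntropy returnMap (univ : Set (Ico (0 : ℝ) 1)) = 0 ∧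
    IsMinimalMap returnMap ∧
    IsUniquelyErgodic returnMap ∧
    -- the invariant probability measure is not absolutely continuous with respect to Lebesgue
    ∀ μ : Measure (Ico (0 : ℝ) 1), IsInvariantProbability returnMap μ →
      ¬ μ ≪ lebesgueIco :=
  ⟨FareyOdometer.coverEntropy_returnMap, FareyOdometer.isMinimalMap_returnMap,
    FareyOdometer.isUniquelyErgodic_returnMap, fun _ hμ =>
      (FareyOdometer.isUniform_of_isInvariantProbability hμ).not_absolutelyContinuous⟩
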